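/- Let $\Lambda\subseteq\mathbb R$ (or, more generally, let $\Lambda$ be any set) be equipped with a $\sigma$-algebra, and let $\xi=\{\xi(t),t\in\mathbb R\}$ be a complex-valued centered second order process on a probability space, with covariance $$\mathsf E\,\xi(t)\overline{\xi(s)}=\int_\Lambda\int_\Lambda f(t,\lambda)\overline{f(s,\mu)}\,F_\xi(d\lambda,d\mu)\qquad(t,s\in\mathbb R),$$ where the integral exists as a Lebesgue integral, $F_\xi$ is a positive definite complex measure on $\Lambda\times\Lambda$ with (finite) total variation $\|F_\xi\|(\Lambda,\Lambda)=\int_\Lambda\int_\Lambda|F_\xi(d\lambda,d\mu)|$, and for each $\lambda\in\Lambda$ the function $f(\cdot,\lambda)$ is entire with $|f(z,\lambda)|\le Me^{\alpha|z|}$ for all $z\in\mathbb C$ and some $M>0$, $\alpha\in\mathbb R$ (a Piranashvili process with exponentially bounded kernel $f$). Let $$\gamma:=\sup_{\lambda\in\Lambda}\limsup_{n\to\infty}|f^{(n)}(0,\lambda)|^{1/n}<w<\infty,$$ where derivatives are with respect to the first variable, and let $$Y_N(\xi;t):=\sum_{n\in\mathbb Z:\,|tw/\pi-n|\le N}\xi\Big(\frac{n\pi}w\Big)\frac{\sin(wt-n\pi)}{wt-n\pi},$$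 $$\widetilde L_f:=\sup_{t\in\mathbb R}\sup_{\lambda\in\Lambda}|f(t,\lambda)|\in[0,\infty],\qquad \widetilde L_0(t):=\frac{4\widetilde L_f\,w\,|\sin(wt)|}{\pi(w-\gamma)(1-e^{-\pi})},$$ where $\frac{\sin x}{x}=1$ at $x=0$ and $0\cdot\infty=0$. Then there is $N_0$ such that for all integers $N\ge N_0$ and all $t\in\mathbb R$ $$\mathsf E\big|\xi(t)-Y_N(\xi;t)\big|^2\le\frac{\widetilde L_0(t)^2}{N^2}\,\|F_\xi\|(\Lambda,\Lambda),$$ and the inequality is strict whenever $\sin(wt)\ne0$, $\widetilde L_f\ne0$ and $\|F_\xi\|(\Lambda,\Lambda)\ne0$. -/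

import Mathlib

open MeasureTheory Filter
open scoped ENNReal ComplexConjugate ComplexOrder

/-- A complex measure `F` on `Λ × Λ` is positive definite if `∑ᵢ ∑ⱼ cᵢ c̄ⱼ F(Sᵢ × Sⱼ)` is real and
nonnegative for all finite families of measurable sets `Sᵢ ⊆ Λ` and complex numbers `cᵢ`. -/
def IsPosDefMeasure {Λ : Type*} [MeasurableSpace Λ] (F : ComplexMeasure (Λ × Λ)) : Prop :=
  ∀ (n : ℕ) (S : Fin n → Set Λ) (c : Fin n → ℂ), (∀ i, MeasurableSet (S i)) →
    0 ≤ ∑ i, ∑ j, c i * conj (c j) * F (S i ×ˢ S j)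

/-- The kernel `f(·, l)`, given as a function on the complex plane, is for every `l` an entire
function with `|f(z, l)| ≤ M exp (α |z|)` for some constants `M > 0` and `α` (these may depend on
`l`). -/
def IsExpBoundedKernel {Λ : Type*} (f : ℂ → Λ → ℂ) : Prop :=
  ∀ l : Λ, Differentiable ℂ (fun z => f z l) ∧
    ∃ M : ℝ, 0 < M ∧ ∃ α : ℝ, ∀ z : ℂ, ‖f z l‖ ≤ M * Real.exp (α * ‖z‖)

/-- The exponential type `γ = sup_l limsup_n |f⁽ⁿ⁾(0, l)|^(1/n)` of a kernel, in `[0, ∞]`. -/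
noncomputable def kernelType {Λ : Type*} (f : ℂ → Λ → ℂ) : ℝ≥0∞ :=
  ⨆ l : Λ, limsup (fun n : ℕ => ‖iteratedDeriv n (fun z => f z l) 0‖ₑ ^ ((1 : ℝ) / n)) atTop

/-- `sup_{t ∈ ℝ} sup_{l ∈ Λ} |f(t, l)|`, in `[0, ∞]`. -/
noncomputable def kernelSup {Λ : Type*} (f : ℂ → Λ → ℂ) : ℝ≥0∞ :=
  ⨆ (t : ℝ) (l : Λ), ‖f (t : ℂ) l‖ₑ

/-- `ξ` is a Piranashvili process on the probability space `(Ω, P)` with kernel `f` and spectral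
measure `F` on `Λ × Λ`: a centered second order process whose covariance has the representation
`E ξ(t) ξ(s)* = ∫∫ f(t, l) f(s, m)* F(dl, dm)`, where `f` is an exponentially bounded kernel and `F`
is a positive definite complex measure of finite total variation. The index set `Λ` is any measurable space, such as a subset
of `ℝ` with some sigma-algebra. -/
structure IsPiranashvili {Ω Λ : Type*} [MeasurableSpace Ω] [MeasurableSpace Λ] (P : Measure Ω)
    (ξ : ℝ → Ω → ℂ) (f : ℂ → Λ → ℂ) (F : ComplexMeasure (Λ × Λ)) : Prop where
  memLp : ∀ t, MemLp (ξ t) 2 P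
  centered : ∀ t, ∫ ω, ξ t ω ∂P = 0
  kernel : IsExpBoundedKernel f
  posDef : IsPosDefMeasure F
  finiteVariation : F.variation Set.univ < ∞
  /-- The double integral in the covariance representation exists as a Lebesgue integral. -/
  integrable : ∀ t s : ℝ,
    Integrable (fun p : Λ × Λ => f (t : ℂ) p.1 * conj (f (s : ℂ) p.2)) F.variation
  covariance : ∀ t s : ℝ, ∫ ω, ξ t ω * conj (ξ s ω) ∂P =
    F.integral (fun p : Λ × Λ => f (t : ℂ) p.1 * conj (f (s : ℂ) p.2))
      (ContinuousLinearMap.mul ℝ ℂ)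

/-- The finite set of sampling indices `{n ∈ ℤ : |t w / π - n| ≤ N}`. -/
noncomputable def sampleIndices (w : ℝ) (N : ℕ) (t : ℝ) : Finset ℤ :=
  Finset.Icc ⌈t * w / Real.pi - N⌉ ⌊t * w / Real.pi + N⌋

theorem mem_sampleIndices (w : ℝ) (N : ℕ) (t : ℝ) (n : ℤ) :
    n ∈ sampleIndices w N t ↔ |t * w / Real.pi - n| ≤ N := by
  rw [sampleIndices, Finset.mem_Icc, Int.ceil_le, Int.le_floor, abs_le]
  constructor <;> rintro ⟨h₁, h₂⟩ <;> constructor <;> linarith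

/-- The time shifted truncated Whittaker–Kotel'nikov–Shannon sum
`Y_N(ξ; t) = ∑_{|tw/π - n| ≤ N} ξ(nπ/w) sin(wt - nπ)/(wt - nπ)`
(with the value `1` of `sin x / x` at `x = 0`). -/
noncomputable def truncSum {Ω : Type*} (w : ℝ) (N : ℕ) (ξ : ℝ → Ω → ℂ) (t : ℝ) (ω : Ω) : ℂ :=
  ∑ n ∈ sampleIndices w N t,
    ξ (n * Real.pi / w) ω * (Real.sinc (w * t - n * Real.pi) : ℂ)

/-- `4 L w |sin(wt)| / (π (w - γ) (1 - e^(-π)))` with `L = kernelSup f` and `γ = kernelType f`, in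
`[0, ∞]` (with `∞ * 0 = 0`). -/
noncomputable def truncConst {Λ : Type*} (w : ℝ) (f : ℂ → Λ → ℂ) (t : ℝ) : ℝ≥0∞ :=
  4 * kernelSup f * ENNReal.ofReal (w * |Real.sin (w * t)| /
    (Real.pi * (w - (kernelType f).toReal) * (1 - Real.exp (-Real.pi))))

/-! The error ξ(t) − Y_N(ξ;t) is a finite linear combination of values of ξ. The covariance formula
turns its second moment into ∫∫ e(λ) conj(e(μ)) F(dλ,dμ), where e(λ) is the error of the same
truncated series for the function f(·,λ). A bound on |e| uniform in λ therefore suffices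
(`IsPiranashvili.lintegral_sum_sq_le`).

That bound is a residue computation (`norm_sub_sum_sinc_le`). Let L = sup |f| on the real axis be
finite; Phragmén–Lindelöf gives |f(z,λ)| ≤ L exp(γ|Im z|). If sin(wt) ≠ 0, then e(λ) is
sin(wt)/(2πi) times the integral of f(z,λ)/((z − t) sin(wz)) around a rectangle enclosing t and the
nodes, with vertical sides at half-integer multiples of π/w. On these sides |sin(wz)| = cosh(w Im
z), so a side at distance d from t contributes at most 4L/(d(w − γ)); the horizontal sides vanish as
the height grows.

For N ≥ 1 both distances are at least Nπ/(2w). The resulting bound is (2/π)(1 − exp(−π)) < 2/3 times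
the claimed one, which gives N₀ = 1 and strictness. The cases sin(wt) = 0 (t is a node and the error
vanishes) and L = ∞ are separate. -/

/-! ### Growth of entire functions of exponential type -/

/-- An entire function whose derivatives at the origin satisfy `limsup |g⁽ⁿ⁾(0)|^(1/n) < τ` is
of exponential type at most `τ`. -/
theorem exists_norm_le_exp_of_limsup_lt {g : ℂ → ℂ} (hg : Differentiable ℂ g) {τ : ℝ}
    (hτ : limsup (fun n : ℕ => ‖iteratedDeriv n g 0‖ₑ ^ ((1 : ℝ) / n)) atTop < ENNReal.ofReal τ) :
    ∃ C : ℝ, ∀ z, ‖g z‖ ≤ C * Real.exp (τ * ‖z‖) := by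
  have hτ0 : 0 < τ := ENNReal.ofReal_pos.1 (bot_le.trans_lt hτ)
  have hev : ∀ᶠ n : ℕ in atTop, ‖iteratedDeriv n g 0‖ ≤ τ ^ n := by
    -- The index n = 0 is excluded because there 1/n is 0 and the root carries no information.
    filter_upwards [eventually_lt_of_limsup_lt hτ, eventually_ge_atTop 1] with n hn hn1
    have hn0 : (n : ℝ) ≠ 0 := by positivity
    have h := ENNReal.rpow_le_rpow hn.le (Nat.cast_nonneg n : (0 : ℝ) ≤ n)
    rw [← ENNReal.rpow_mul, one_div_mul_cancel hn0, ENNReal.rpow_one, ENNReal.rpow_natCast,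
      ← ENNReal.ofReal_pow hτ0.le, ← ofReal_norm,
      ENNReal.ofReal_le_ofReal_iff (by positivity)] at h
    exact h
  have hO : (fun n : ℕ => iteratedDeriv n g 0) =O[atTop] fun n : ℕ => τ ^ n :=
    Asymptotics.IsBigO.of_bound 1 <| hev.mono fun n hn => by
      simpa [abs_of_pos hτ0] using hn
  -- Since τ ^ n never vanishes, enlarging the constant covers the finitely many exceptional n; the
  -- Taylor series is then dominated by that of C exp(τ|z|).
  obtain ⟨C, -, hC⟩ := Asymptotics.bound_of_isBigO_nat_atTop hO
  refine ⟨C, fun z => ?_⟩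
  have hT := Complex.hasSum_taylorSeries_of_entire hg 0 z
  have hE := (NormedSpace.expSeries_div_hasSum_exp (τ * ‖z‖)).mul_left C
  rw [← Real.exp_eq_exp_ℝ] at hE
  rw [← hT.tsum_eq]
  refine tsum_of_norm_bounded hE fun n => ?_
  have h1 : ‖iteratedDeriv n g 0‖ ≤ C * τ ^ n := by
    simpa [abs_of_pos hτ0] using hC (x := n) (by positivity)
  simp only [sub_zero, smul_eq_mul, norm_mul, norm_inv, norm_pow, RCLike.norm_natCast]
  calc _ = ‖iteratedDeriv n g 0‖ * (‖z‖ ^ n / n.factorial) := by ring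
    _ ≤ C * τ ^ n * (‖z‖ ^ n / n.factorial) := by gcongr
    _ = _ := by ring

/-- Phragmén–Lindelöf in the right half-plane for g(iζ) exp(−τζ): the rotation sends the imaginary
axis to the real axis of g, where the extra factor has modulus 1, and on the positive real axis that
factor cancels the growth of g. -/
theorem norm_le_exp_im_of_nonneg {g : ℂ → ℂ} (hg : Differentiable ℂ g) {C L τ : ℝ}
    (hC : ∀ z, ‖g z‖ ≤ C * Real.exp (τ * ‖z‖)) (hL : ∀ x : ℝ, ‖g x‖ ≤ L) {z : ℂ}
    (hz : 0 ≤ z.im) : ‖g z‖ ≤ L * Real.exp (τ * z.im) := by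
  have key := PhragmenLindelof.right_half_plane_of_bounded_on_real (C := L)
    (f := fun ζ : ℂ => g (Complex.I * ζ) * Complex.exp (-τ * ζ)) (z := -Complex.I * z)
    (Differentiable.diffContOnCl (by fun_prop)) ⟨1, by norm_num, τ + |τ|, ?_⟩ ?_ ?_ ?_
  · simp only [norm_mul, Complex.norm_exp] at key
    have e : Complex.I * (-Complex.I * z) = z := by
      rw [← mul_assoc]; simp
    rw [e] at key
    have e2 : (-(τ : ℂ) * (-Complex.I * z)).re = -(τ * z.im) := by simp
    rw [e2, Real.exp_neg, ← div_eq_mul_inv, div_le_iff₀ (Real.exp_pos _)] at key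
    exact key
  · refine Asymptotics.IsBigO.of_bound C (Eventually.of_forall fun ζ => ?_)
    have h := hC (Complex.I * ζ)
    have hC0 : 0 ≤ C := by
      have := (norm_nonneg _).trans (hC 0)
      simpa using this
    simp only [norm_mul, Complex.norm_I, one_mul, Complex.norm_exp, Real.rpow_one, Real.norm_eq_abs,
      Real.abs_exp] at h ⊢
    calc _ ≤ C * Real.exp (τ * ‖ζ‖) * Real.exp (|τ| * ‖ζ‖) := by
          gcongr
          calc (-(τ : ℂ) * ζ).re ≤ ‖-(τ : ℂ) * ζ‖ := Complex.re_le_norm _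
            _ = |τ| * ‖ζ‖ := by simp
      _ = _ := by rw [mul_assoc, ← Real.exp_add, add_mul]
  · refine isBoundedUnder_of_eventually_le (a := C) ?_
    filter_upwards [eventually_ge_atTop 0] with x hx
    have h := hC (Complex.I * x)
    simp only [norm_mul, Complex.norm_I, one_mul, Complex.norm_exp, Complex.norm_real,
      Real.norm_eq_abs, abs_of_nonneg hx] at h ⊢
    have e2 : (-(τ : ℂ) * x).re = -(τ * x) := by simp
    rw [e2, Real.exp_neg, ← div_eq_mul_inv, div_le_iff₀ (Real.exp_pos _)]
    exact h
  · intro x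
    have e : Complex.I * (x * Complex.I) = ((-x : ℝ) : ℂ) := by
      push_cast; linear_combination (x : ℂ) * Complex.I_mul_I
    simp only [norm_mul, e, Complex.norm_exp]
    simpa using hL (-x)
  · simpa using hz

/-- A function of exponential type `τ` bounded by `L` on the real axis is bounded by
`L exp (τ |Im z|)`. -/
theorem norm_le_exp_abs_im {g : ℂ → ℂ} (hg : Differentiable ℂ g) {C L τ : ℝ}
    (hC : ∀ z, ‖g z‖ ≤ C * Real.exp (τ * ‖z‖)) (hL : ∀ x : ℝ, ‖g x‖ ≤ L) (z : ℂ) :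
    ‖g z‖ ≤ L * Real.exp (τ * |z.im|) := by
  rcases le_total 0 z.im with h | h
  · rw [abs_of_nonneg h]
    exact norm_le_exp_im_of_nonneg hg hC hL h
  · rw [abs_of_nonpos h]
    simpa using norm_le_exp_im_of_nonneg (g := fun z => g (-z)) (z := -z) (L := L) (by fun_prop)
      (fun z => by simpa using hC (-z)) (fun x => by simpa using hL (-x)) (by simpa using h)

/-! ### Contour integrals over rectangles and a residue theorem -/

/-- The integral over the boundary of the rectangle `[a, b] × [-Y, Y]`. -/
noncomputable def rectIntegral (φ : ℂ → ℂ) (a b Y : ℝ) : ℂ :=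
  (∫ x in a..b, φ (x + (-Y : ℝ) * Complex.I)) - (∫ x in a..b, φ (x + Y * Complex.I)) +
    Complex.I * (∫ y in (-Y)..Y, φ (b + y * Complex.I)) -
    Complex.I * (∫ y in (-Y)..Y, φ (a + y * Complex.I))

/-- The horizontal sides of the rectangle `[a, b] × [-Y, Y]` and the vertical lines through its
vertical sides. -/
def rectLines (a b Y : ℝ) : Set ℂ :=
  {z | a ≤ z.re ∧ z.re ≤ b ∧ (z.re = a ∨ z.re = b ∨ z.im = Y ∨ z.im = -Y)}

/-- Because `rectLines` contains entire vertical lines, the vertical integrands are continuous on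
all of ℝ and the sign of Y plays no role. -/
theorem ContinuousOn.intervalIntegrable_rectLines {φ : ℂ → ℂ} {a b Y : ℝ} (hab : a ≤ b)
    (h : ContinuousOn φ (rectLines a b Y)) :
    IntervalIntegrable (fun x : ℝ => φ (x + (-Y : ℝ) * Complex.I)) volume a b ∧
    IntervalIntegrable (fun x : ℝ => φ (x + Y * Complex.I)) volume a b ∧
    IntervalIntegrable (fun y : ℝ => φ (b + y * Complex.I)) volume (-Y) Y ∧
    IntervalIntegrable (fun y : ℝ => φ (a + y * Complex.I)) volume (-Y) Y := by
  refine ⟨ContinuousOn.intervalIntegrable (h.comp (by fun_prop) fun x hx => ?_),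
    ContinuousOn.intervalIntegrable (h.comp (by fun_prop) fun x hx => ?_),
    Continuous.intervalIntegrable (h.comp_continuous (by fun_prop) fun x => ?_) _ _,
    Continuous.intervalIntegrable (h.comp_continuous (by fun_prop) fun x => ?_) _ _⟩
  · rw [Set.uIcc_of_le hab] at hx
    simp [rectLines, hx.1, hx.2]
  · rw [Set.uIcc_of_le hab] at hx
    simp [rectLines, hx.1, hx.2]
  · simp [rectLines, hab]
  · simp [rectLines, hab]

theorem rectIntegral_add {φ ψ : ℂ → ℂ} {a b Y : ℝ} (hab : a ≤ b)
    (hφ : ContinuousOn φ (rectLines a b Y)) (hψ : ContinuousOn ψ (rectLines a b Y)) :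
    rectIntegral (fun z => φ z + ψ z) a b Y = rectIntegral φ a b Y + rectIntegral ψ a b Y := by
  obtain ⟨h1, h2, h3, h4⟩ := hφ.intervalIntegrable_rectLines hab
  obtain ⟨k1, k2, k3, k4⟩ := hψ.intervalIntegrable_rectLines hab
  simp only [rectIntegral]
  rw [intervalIntegral.integral_add h1 k1, intervalIntegral.integral_add h2 k2,
    intervalIntegral.integral_add h3 k3, intervalIntegral.integral_add h4 k4]
  ring

theorem rectIntegral_const_mul (c : ℂ) (φ : ℂ → ℂ) (a b Y : ℝ) :
    rectIntegral (fun z => c * φ z) a b Y = c * rectIntegral φ a b Y := by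
  simp only [rectIntegral, intervalIntegral.integral_const_mul]
  ring

theorem rectIntegral_congr {φ ψ : ℂ → ℂ} {a b Y : ℝ} (hab : a ≤ b)
    (h : Set.EqOn φ ψ (rectLines a b Y)) :
    rectIntegral φ a b Y = rectIntegral ψ a b Y := by
  have h3 : ∀ y : ℝ, φ (b + y * Complex.I) = ψ (b + y * Complex.I) :=
    fun x => h (by simp [rectLines, hab])
  have h4 : ∀ y : ℝ, φ (a + y * Complex.I) = ψ (a + y * Complex.I) :=
    fun x => h (by simp [rectLines, hab])
  have h5 : ∀ s : ℝ, s = Y ∨ s = -Y →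
      ∫ x in a..b, φ (x + s * Complex.I) = ∫ x in a..b, ψ (x + s * Complex.I) := fun s hs =>
    intervalIntegral.integral_congr fun x hx => h (by
      rw [Set.uIcc_of_le hab] at hx
      simpa [rectLines, hx.1, hx.2] using Or.inr (Or.inr hs))
  simp only [rectIntegral, h3, h4, h5 Y (Or.inl rfl), h5 (-Y) (Or.inr rfl)]

theorem rectIntegral_eq_zero {φ : ℂ → ℂ} {a b Y : ℝ} (hab : a ≤ b)
    (h : ∀ z : ℂ, a ≤ z.re → z.re ≤ b → DifferentiableAt ℂ φ z) : rectIntegral φ a b Y = 0 := by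
  have := Complex.integral_boundary_rect_eq_zero_of_differentiableOn φ (a + (-Y : ℝ) * Complex.I)
    (b + Y * Complex.I) fun z hz => by
      have hz1 := hz.1
      simp only [Set.mem_preimage, Complex.add_re, Complex.ofReal_re, Complex.mul_re, Complex.I_re,
        mul_zero, Complex.ofReal_im, Complex.I_im, mul_one, sub_self, add_zero,
        Set.uIcc_of_le hab, Set.mem_Icc] at hz1
      exact (h z hz1.1 hz1.2).differentiableWithinAt
  simpa [rectIntegral] using this

/-- The primitive arctan(y/d) − (i/2) log(d² + y²) avoids branches of the complex logarithm; its
logarithmic part is even in y and cancels between −Y and Y. -/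
theorem integral_inv_add_mul_I {d : ℝ} (hd : d ≠ 0) (Y : ℝ) :
    ∫ y in (-Y)..Y, ((d : ℂ) + y * Complex.I)⁻¹ = (2 * Real.arctan (Y / d) : ℝ) := by
  have hne : ∀ y : ℝ, (d : ℂ) + y * Complex.I ≠ 0 := fun y h => hd (by
    simpa using congrArg Complex.re h)
  have hpos : ∀ y : ℝ, d ^ 2 + y ^ 2 ≠ 0 := fun y => by positivity
  have hder : ∀ y : ℝ, HasDerivAt (fun y : ℝ => ((Real.arctan (y / d) : ℝ) : ℂ) -
      ((Real.log (d ^ 2 + y ^ 2) / 2 : ℝ) : ℂ) * Complex.I) ((d : ℂ) + y * Complex.I)⁻¹ y := by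
    intro y
    have h1 : HasDerivAt (fun y : ℝ => Real.arctan (y / d)) (d / (d ^ 2 + y ^ 2)) y := by
      convert ((hasDerivAt_id y).div_const d).arctan using 1
      have := hpos y
      simp only [id]
      field_simp
      simp
    have h2 : HasDerivAt (fun y : ℝ => Real.log (d ^ 2 + y ^ 2) / 2) (y / (d ^ 2 + y ^ 2)) y := by
      refine ((((hasDerivAt_id' y).fun_pow 2).const_add (d ^ 2)).log (hpos y)).div_const 2
        |>.congr_deriv ?_
      simp
      ring
    refine (h1.ofReal_comp.sub (h2.ofReal_comp.mul_const Complex.I)).congr_deriv ?_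
    symm
    have h3 : (d : ℂ) ^ 2 + (y : ℂ) ^ 2 ≠ 0 := by exact_mod_cast hpos y
    rw [inv_eq_one_div, div_eq_iff (hne y)]
    push_cast
    field_simp
    linear_combination ((y : ℂ) ^ 2) * Complex.I_sq
  rw [intervalIntegral.integral_eq_sub_of_hasDerivAt (fun y _ => hder y)]
  · rw [neg_div, Real.arctan_neg, neg_sq]
    push_cast
    ring
  · exact Continuous.intervalIntegrable (Continuous.inv₀ (by fun_prop) hne) _ _

theorem tendsto_integral_inv_horizontal (a b p : ℝ) (s : ℝ) (hs : |s| = 1) :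
    Tendsto (fun Y : ℝ => ∫ x in a..b, ((x : ℂ) + (s * Y : ℝ) * Complex.I - p)⁻¹) atTop
      (nhds 0) := by
  have h0 : Tendsto (fun Y : ℝ => Y⁻¹ * |b - a|) atTop (nhds 0) := by
    simpa using tendsto_inv_atTop_zero.mul_const |b - a|
  refine squeeze_zero_norm' ?_ h0
  filter_upwards [eventually_gt_atTop 0] with Y hY
  refine intervalIntegral.norm_integral_le_of_norm_le_const fun x _ => ?_
  rw [norm_inv]
  refine inv_anti₀ hY ?_
  calc Y = |(x + (s * Y : ℝ) * Complex.I - p : ℂ).im| := by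
        simp [abs_mul, hs, abs_of_pos hY]
    _ ≤ _ := Complex.abs_im_le_norm _

/-- Each vertical side contributes πi in the limit, since the two arctangents tend to π/2 and −π/2
on opposite sides of p; the horizontal sides are O(1/Y). -/
theorem tendsto_rectIntegral_inv {a b p : ℝ} (ha : a < p) (hb : p < b) :
    Tendsto (rectIntegral (fun z => (z - p)⁻¹) a b) atTop (nhds (2 * Real.pi * Complex.I)) := by
  have h1 := tendsto_integral_inv_horizontal a b p (-1) (by simp)
  have h2 := tendsto_integral_inv_horizontal a b p 1 (by simp)
  have h3 : Tendsto (fun Y : ℝ => ((2 * Real.arctan (Y / (b - p)) : ℝ) : ℂ)) atTop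
      (nhds Real.pi) := by
    have : Tendsto (fun Y : ℝ => 2 * Real.arctan (Y / (b - p))) atTop (nhds (2 * (Real.pi / 2))) :=
      ((Real.tendsto_arctan_atTop.mono_right nhdsWithin_le_nhds).comp
        (tendsto_id.atTop_div_const (sub_pos.2 hb))).const_mul 2
    rw [mul_div_cancel₀ _ two_ne_zero] at this
    exact (Complex.continuous_ofReal.tendsto _).comp this
  have h4 : Tendsto (fun Y : ℝ => ((2 * Real.arctan (Y / (a - p)) : ℝ) : ℂ)) atTop
      (nhds (-Real.pi : ℝ)) := by
    have : Tendsto (fun Y : ℝ => 2 * Real.arctan (Y / (a - p))) atTop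
        (nhds (2 * (-(Real.pi / 2)))) :=
      ((Real.tendsto_arctan_atBot.mono_right nhdsWithin_le_nhds).comp
        (tendsto_id.atTop_div_const_of_neg (sub_neg.2 ha))).const_mul 2
    rw [mul_neg, mul_div_cancel₀ _ two_ne_zero] at this
    exact (Complex.continuous_ofReal.tendsto _).comp this
  have h := ((h1.sub h2).add (h3.const_mul Complex.I)).sub (h4.const_mul Complex.I)
  convert h using 2 with Y
  · rw [← integral_inv_add_mul_I (sub_pos.2 hb).ne', ← integral_inv_add_mul_I (sub_neg.2 ha).ne]
    simp only [rectIntegral, one_mul, neg_mul]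
    have e : ∀ c y : ℝ, (c : ℂ) + y * Complex.I - p = (c - p : ℝ) + y * Complex.I := by
      intro c y; push_cast; ring
    simp only [e]
  · push_cast; ring

theorem continuousOn_const_div_sub_rectLines {a b p Y : ℝ} (ha : a < p) (hb : p < b) (hY : 0 < Y)
    (c : ℂ) : ContinuousOn (fun z : ℂ => c * (z - p)⁻¹) (rectLines a b Y) := by
  refine continuousOn_const.mul (ContinuousOn.inv₀ (by fun_prop) fun z hz h => ?_)
  rw [sub_eq_zero] at h
  subst h
  rcases hz.2.2 with h | h | h | h <;> simp at h <;> linarith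

theorem tendsto_rectIntegral_sum {a b : ℝ} (P : Finset ℝ) (hP : ∀ p ∈ P, a < p ∧ p < b)
    (c : ℝ → ℂ) :
    Tendsto (rectIntegral (fun z => ∑ p ∈ P, c p * (z - p)⁻¹) a b) atTop
      (nhds (2 * Real.pi * Complex.I * ∑ p ∈ P, c p)) := by
  induction P using Finset.induction_on with
  | empty =>
    have : rectIntegral (fun _ => 0) a b = fun _ => 0 := by
      ext Y; simp [rectIntegral]
    simp [this]
  | insert q P hq ih =>
    simp only [Finset.forall_mem_insert] at hP
    have h1 := ((tendsto_rectIntegral_inv hP.1.1 hP.1.2).const_mul (c q)).add (ih hP.2)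
    simp only [Finset.sum_insert hq]
    rw [mul_add, mul_comm _ (c q)]
    refine h1.congr' ?_
    filter_upwards [eventually_gt_atTop 0] with Y hY
    rw [rectIntegral_add (hP.1.1.trans hP.1.2).le (continuousOn_const_div_sub_rectLines hP.1.1 hP.1.2 hY _),
      rectIntegral_const_mul]
    exact continuousOn_finsetSum _ fun p hp =>
      continuousOn_const_div_sub_rectLines (hP.2 p hp).1 (hP.2 p hp).2 hY _

theorem differentiable_dslope {h : ℂ → ℂ} (hh : Differentiable ℂ h) (c : ℂ) :
    Differentiable ℂ (dslope h c) := by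
  rw [← differentiableOn_univ, Complex.differentiableOn_dslope Filter.univ_mem]
  exact hh.differentiableOn

/-- An entire function vanishing on a finite set is divisible by the corresponding polynomial. -/
theorem exists_eq_prod_sub_mul (P : Finset ℂ) {h : ℂ → ℂ} (hh : Differentiable ℂ h)
    (h0 : ∀ p ∈ P, h p = 0) :
    ∃ H : ℂ → ℂ, Differentiable ℂ H ∧ ∀ z, h z = (∏ p ∈ P, (z - p)) * H z := by
  induction P using Finset.induction_on generalizing h with
  | empty => exact ⟨h, hh, fun z => by simp⟩
  | insert q P hq ih =>
    simp only [Finset.forall_mem_insert] at h0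
    have key : ∀ z, h z = (z - q) * dslope h q z := fun z => by
      have := sub_smul_dslope h q z
      rw [h0.1, sub_zero, smul_eq_mul] at this
      exact this.symm
    obtain ⟨H, hH, hE⟩ := ih (differentiable_dslope hh q) fun p hp => by
      have h1 := key p
      rw [h0.2 p hp, eq_comm, mul_eq_zero, sub_eq_zero] at h1
      rcases h1 with rfl | h1
      · exact absurd hp hq
      · exact h1
    refine ⟨H, hH, fun z => ?_⟩
    rw [key, hE, Finset.prod_insert hq, mul_assoc]

/-- Residue theorem for a quotient of entire functions in a vertical strip in which the denominator
has only simple real zeros. -/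
theorem tendsto_rectIntegral_div {u v : ℂ → ℂ} (hu : Differentiable ℂ u) (hv : Differentiable ℂ v)
    {a b : ℝ} (hab : a ≤ b) (P : Finset ℝ) (hP : ∀ p ∈ P, a < p ∧ p < b) (hv0 : ∀ p ∈ P, v p = 0)
    (hv1 : ∀ p ∈ P, deriv v p ≠ 0)
    (hne : ∀ z : ℂ, a ≤ z.re → z.re ≤ b → (∀ p ∈ P, z ≠ (p : ℝ)) → v z ≠ 0) :
    Tendsto (rectIntegral (fun z => u z / v z) a b) atTop
      (nhds (2 * Real.pi * Complex.I * ∑ p ∈ P, u p / deriv v p)) := by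
  classical
  let Q : Finset ℂ := P.image ((↑) : ℝ → ℂ)
  obtain ⟨S, hS, hvS⟩ := exists_eq_prod_sub_mul Q hv (by simpa [Q] using hv0)
  -- Here `dslope v p` is v(z)/(z − p) with the value v'(p) at p. Subtracting the principal parts,
  -- multiplied by v, leaves a numerator that vanishes on all of P.
  let n : ℂ → ℂ := fun z => u z - ∑ p ∈ P, u p / deriv v p * dslope v p z
  have hn : Differentiable ℂ n := hu.sub <| Differentiable.fun_sum fun p _ =>
    (differentiable_dslope hv p).const_mul _
  have hds : ∀ p ∈ P, ∀ z : ℂ, z ≠ p → dslope v p z = v z * (z - p)⁻¹ := fun p hp z hz => by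
    rw [dslope_of_ne _ hz, slope_def_field, hv0 p hp, sub_zero, div_eq_mul_inv]
  obtain ⟨H, hH, hnH⟩ := exists_eq_prod_sub_mul Q hn (by
    simp only [Q, Finset.forall_mem_image]
    intro q hq
    simp only [n]
    rw [Finset.sum_eq_single_of_mem q hq fun p hp hpq => ?_, dslope_same,
      div_mul_cancel₀ _ (hv1 q hq), sub_self]
    rw [hds p hp _ (by exact_mod_cast hpq.symm), hv0 q hq, zero_mul, mul_zero])
  -- At p ∈ P a zero of S would make p a multiple zero of v, against v'(p) ≠ 0; elsewhere in the
  -- strip v itself has no zero.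
  have hS0 : ∀ z : ℂ, a ≤ z.re → z.re ≤ b → S z ≠ 0 := by
    intro z hza hzb h0
    by_cases hz : ∃ p ∈ P, z = (p : ℝ)
    · obtain ⟨p, hp, rfl⟩ := hz
      refine hv1 p hp ?_
      have hpQ : (p : ℂ) ∈ Q := Finset.mem_image_of_mem _ hp
      have e : v = fun z => (z - p) * ((∏ q ∈ Q.erase p, (z - q)) * S z) := by
        ext z
        rw [hvS, ← Finset.mul_prod_erase _ _ hpQ, mul_assoc]
      have hd : HasDerivAt (fun z : ℂ => z - p) 1 (p : ℂ) := (hasDerivAt_id _).sub_const _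
      have hd2 : DifferentiableAt ℂ (fun z => (∏ q ∈ Q.erase p, (z - q)) * S z) (p : ℂ) := by
        fun_prop
      rw [e]
      refine (hd.mul hd2.hasDerivAt).deriv.trans ?_
      simp [h0]
    · push Not at hz
      exact hne z hza hzb hz (by rw [hvS, h0, mul_zero])
  have hzero : ∀ Y, rectIntegral (fun z => H z / S z) a b Y = 0 := fun Y =>
    rectIntegral_eq_zero hab fun z hza hzb => (hH z).div (hS z) (hS0 z hza hzb)
  have hmem : ∀ Y : ℝ, 0 < Y → ∀ z ∈ rectLines a b Y, ∀ p ∈ P, z ≠ (p : ℝ) := by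
    rintro Y hY z hz p hp rfl
    have := hP p hp
    rcases hz.2.2 with h | h | h | h <;> simp at h <;> linarith
  -- On the contour u/v is H/S plus the principal parts, and H/S is holomorphic in the strip, so
  -- only the principal parts contribute.
  refine (tendsto_rectIntegral_sum P hP fun p => u p / deriv v p).congr' ?_
  filter_upwards [eventually_gt_atTop 0] with Y hY
  rw [← zero_add (rectIntegral _ a b Y), ← hzero Y, ← rectIntegral_add hab]
  · refine rectIntegral_congr hab fun z hz => ?_
    have hvz := hne z hz.1 hz.2.1 (hmem Y hY z hz)
    have h1 : (∏ q ∈ Q, (z - q)) ≠ 0 := left_ne_zero_of_mul (hvS z ▸ hvz)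
    have h2 : H z / S z = n z / v z := by
      rw [hnH, hvS, mul_div_mul_left _ _ h1]
    have h3 : n z = u z - v z * ∑ p ∈ P, u p / deriv v p * (z - p)⁻¹ := by
      rw [Finset.mul_sum]
      refine congrArg (u z - ·) (Finset.sum_congr rfl fun p hp => ?_)
      rw [hds p hp z (hmem Y hY z hz p hp)]
      ring
    simp only [h2, h3]
    field_simp
    ring
  · exact hH.continuous.continuousOn.div hS.continuous.continuousOn fun z hz => hS0 z hz.1 hz.2.1
  · exact continuousOn_finsetSum _ fun p hp =>
      continuousOn_const_div_sub_rectLines (hP p hp).1 (hP p hp).2 hY _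

/-! ### Estimates of the remainder integrand on the contour -/

/-- This gives both lower bounds for the sine: cosh y where sin² x = 1 (vertical sides) and |sinh y|
for every x (horizontal sides). -/
theorem norm_sin_add_mul_I_sq (x y : ℝ) :
    ‖Complex.sin (x + y * Complex.I)‖ ^ 2 = Real.sin x ^ 2 + Real.sinh y ^ 2 := by
  have e : Complex.sin (x + y * Complex.I) = (Real.sin x * Real.cosh y : ℝ) +
      (Real.cos x * Real.sinh y : ℝ) * Complex.I := by
    rw [Complex.sin_add_mul_I]; push_cast; ring
  rw [e, ← Complex.normSq_eq_norm_sq, Complex.normSq_add_mul_I, mul_pow, mul_pow, Real.cosh_sq,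
    Real.cos_sq']
  ring

theorem integral_exp_neg_mul_abs_le {δ : ℝ} (hδ : 0 < δ) (Y : ℝ) :
    ∫ y in (-Y)..Y, Real.exp (-(δ * |y|)) ≤ 2 / δ := by
  have hc : Continuous fun y : ℝ => Real.exp (-(δ * |y|)) := by fun_prop
  have h1 : ∫ y in (-Y)..0, Real.exp (-(δ * |y|)) = ∫ y in (0 : ℝ)..Y, Real.exp (-(δ * |y|)) := by
    have := intervalIntegral.integral_comp_neg (a := 0) (b := Y)
      (fun y : ℝ => Real.exp (-(δ * |y|)))
    simpa using this.symm
  have h2 : ∫ y in (0 : ℝ)..Y, Real.exp (-(δ * |y|)) ≤ 1 / δ := by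
    rcases le_total Y 0 with hY | hY
    · rw [intervalIntegral.integral_symm]
      have : 0 ≤ ∫ y in Y..0, Real.exp (-(δ * |y|)) :=
        intervalIntegral.integral_nonneg hY fun y _ => (Real.exp_pos _).le
      have : 0 < 1 / δ := by positivity
      linarith
    · have h3 : ∫ y in (0 : ℝ)..Y, Real.exp (-(δ * |y|)) =
          ∫ y in (0 : ℝ)..Y, Real.exp (-(δ * y)) :=
        intervalIntegral.integral_congr fun y hy => by
          rw [Set.uIcc_of_le hY] at hy
          simp only [abs_of_nonneg hy.1]
      have h4 : ∀ y : ℝ, HasDerivAt (fun y : ℝ => -(Real.exp (-(δ * y)) / δ))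
          (Real.exp (-(δ * y))) y := fun y => by
        refine (((hasDerivAt_id' y).const_mul δ).fun_neg.exp.div_const δ).fun_neg.congr_deriv ?_
        field_simp
      rw [h3, intervalIntegral.integral_eq_sub_of_hasDerivAt (fun y _ => h4 y)
        (Continuous.intervalIntegrable (by fun_prop) _ _)]
      have : 0 < Real.exp (-(δ * Y)) / δ := by positivity
      simp only [mul_zero, neg_zero, Real.exp_zero]
      linarith
  rw [← intervalIntegral.integral_add_adjacent_intervals (hc.intervalIntegrable (-Y) 0)
    (hc.intervalIntegrable 0 Y), h1]
  calc _ ≤ 1 / δ + 1 / δ := add_le_add h2 h2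
    _ = 2 / δ := by ring

theorem norm_integral_le_of_norm_le_exp_neg_abs {φ : ℝ → ℂ} {K δ Y : ℝ} (hδ : 0 < δ) (hY : 0 ≤ Y)
    (h : ∀ y, ‖φ y‖ ≤ K * Real.exp (-(δ * |y|))) :
    ‖∫ y in (-Y)..Y, φ y‖ ≤ 2 * K / δ := by
  have hK : 0 ≤ K := by
    have := (norm_nonneg _).trans (h 0)
    simpa using this
  calc ‖∫ y in (-Y)..Y, φ y‖ ≤ ∫ y in (-Y)..Y, K * Real.exp (-(δ * |y|)) :=
        intervalIntegral.norm_integral_le_of_norm_le (by linarith)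
          (Eventually.of_forall fun y _ => h y)
          (Continuous.intervalIntegrable (by fun_prop) _ _)
    _ = K * ∫ y in (-Y)..Y, Real.exp (-(δ * |y|)) := intervalIntegral.integral_const_mul _ _
    _ ≤ K * (2 / δ) := by gcongr; exact integral_exp_neg_mul_abs_le hδ Y
    _ = 2 * K / δ := by ring

theorem eventually_exp_le_four_mul_sinh {w : ℝ} (hw : 0 < w) :
    ∀ᶠ Y : ℝ in atTop, Real.exp (w * Y) ≤ 4 * Real.sinh (w * Y) := by
  filter_upwards [eventually_ge_atTop (1 / w)] with Y hY
  have h1 : 1 ≤ w * Y := by rwa [div_le_iff₀' hw] at hY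
  have h2 : 2 ≤ Real.exp (w * Y) := by linarith [Real.add_one_le_exp (w * Y)]
  rw [Real.sinh_eq, Real.exp_neg]
  have h3 : (Real.exp (w * Y))⁻¹ ≤ 2⁻¹ := inv_anti₀ (by norm_num) h2
  linarith

/-- The kernel `g(z) / ((z - t) sin(wz))` of the sampling remainder decays exponentially on vertical
lines on which `|sin(wc)| = 1`. -/
theorem norm_div_sub_mul_sin_vertical_le {g : ℂ → ℂ} {L γ w t c : ℝ}
    (hb : ∀ z : ℂ, ‖g z‖ ≤ L * Real.exp (γ * |z.im|)) (hw : 0 < w)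
    (hc : Real.sin (w * c) ^ 2 = 1) (hct : c ≠ t) (y : ℝ) :
    ‖g (c + y * Complex.I) / ((c + y * Complex.I - t) * Complex.sin (w * (c + y * Complex.I)))‖ ≤
      2 * L / |c - t| * Real.exp (-((w - γ) * |y|)) := by
  have hL : 0 ≤ L := by simpa using (norm_nonneg _).trans (hb 0)
  have hs : Real.exp (w * |y|) / 2 ≤ ‖Complex.sin (w * (c + y * Complex.I))‖ := by
    have e : (w : ℂ) * (c + y * Complex.I) = (w * c : ℝ) + (w * y : ℝ) * Complex.I := by
      push_cast; ring
    have h1 := norm_sin_add_mul_I_sq (w * c) (w * y)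
    rw [hc, add_comm (1 : ℝ), ← Real.cosh_sq] at h1
    rw [e, (sq_eq_sq₀ (norm_nonneg _) (Real.cosh_pos _).le).1 h1, ← Real.cosh_abs, abs_mul,
      abs_of_pos hw, Real.cosh_eq]
    have := Real.exp_pos (-(w * |y|))
    linarith
  have hd : |c - t| ≤ ‖(c + y * Complex.I - t : ℂ)‖ := by
    simpa using Complex.abs_re_le_norm (c + y * Complex.I - t : ℂ)
  have hd0 : 0 < |c - t| := abs_pos.2 (sub_ne_zero.2 hct)
  have hg : ‖g (c + y * Complex.I)‖ ≤ L * Real.exp (γ * |y|) := by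
    simpa using hb (c + y * Complex.I)
  rw [norm_div, norm_mul]
  calc _ ≤ L * Real.exp (γ * |y|) / (|c - t| * (Real.exp (w * |y|) / 2)) := by gcongr
    _ = _ := by
      rw [show -((w - γ) * |y|) = γ * |y| - w * |y| by ring, Real.exp_sub]
      field_simp

/-- The crude replacement of γ by w in the exponent suffices: the exponentials cancel, and the
factor 1/|z − t| ≤ 1/Y remains, which tends to 0 on sides of fixed length. -/
theorem norm_div_sub_mul_sin_horizontal_le {g : ℂ → ℂ} {L γ w t s Y : ℝ}
    (hb : ∀ z : ℂ, ‖g z‖ ≤ L * Real.exp (γ * |z.im|)) (hw : 0 < w) (hγ : γ < w) (hY : 0 < Y)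
    (hs : |s| = Y) (hsinh : Real.exp (w * Y) ≤ 4 * Real.sinh (w * Y)) (x : ℝ) :
    ‖g (x + s * Complex.I) / ((x + s * Complex.I - t) * Complex.sin (w * (x + s * Complex.I)))‖ ≤
      4 * L / Y := by
  have hL : 0 ≤ L := by simpa using (norm_nonneg _).trans (hb 0)
  have hsin : Real.exp (w * Y) / 4 ≤ ‖Complex.sin (w * (x + s * Complex.I))‖ := by
    have e : (w : ℂ) * (x + s * Complex.I) = (w * x : ℝ) + (w * s : ℝ) * Complex.I := by
      push_cast; ring
    have h1 := norm_sin_add_mul_I_sq (w * x) (w * s)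
    rw [e]
    refine le_trans (by linarith) (abs_le_of_sq_le_sq' (a := Real.sinh (w * Y)) ?_
      (norm_nonneg _)).2
    have h2 : Real.sinh (w * Y) ^ 2 = Real.sinh (w * s) ^ 2 := by
      rw [← hs, ← abs_of_pos hw, ← abs_mul, abs_of_pos hw, ← Real.abs_sinh, sq_abs]
    rw [h1, h2]
    nlinarith [sq_nonneg (Real.sin (w * x))]
  have hd : Y ≤ ‖(x + s * Complex.I - t : ℂ)‖ := by
    simpa [hs] using Complex.abs_im_le_norm (x + s * Complex.I - t : ℂ)
  have hg : ‖g (x + s * Complex.I)‖ ≤ L * Real.exp (w * Y) := by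
    refine (hb (x + s * Complex.I)).trans ?_
    have : |(x + s * Complex.I : ℂ).im| = Y := by simpa using hs
    rw [this]
    gcongr
  rw [norm_div, norm_mul]
  calc _ ≤ L * Real.exp (w * Y) / (Y * (Real.exp (w * Y) / 4)) := by gcongr
    _ = _ := by field_simp

theorem norm_rectIntegral_div_sub_mul_sin_le {g : ℂ → ℂ} {L γ w t a b Y : ℝ}
    (hb : ∀ z : ℂ, ‖g z‖ ≤ L * Real.exp (γ * |z.im|)) (hw : 0 < w) (hγ : γ < w) (hY : 0 < Y)
    (hsinh : Real.exp (w * Y) ≤ 4 * Real.sinh (w * Y)) (hat : a < t) (htb : t < b)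
    (ha : Real.sin (w * a) ^ 2 = 1) (hb1 : Real.sin (w * b) ^ 2 = 1) :
    ‖rectIntegral (fun z => g z / ((z - t) * Complex.sin (w * z))) a b Y‖ ≤
      8 * L * (b - a) * Y⁻¹ + 4 * L / (w - γ) * (1 / (b - t) + 1 / (t - a)) := by
  have h1 := intervalIntegral.norm_integral_le_of_norm_le_const (a := a) (b := b) fun x _ =>
    norm_div_sub_mul_sin_horizontal_le (t := t) (s := -Y) hb hw hγ hY
      (by rw [abs_neg, abs_of_pos hY]) hsinh x
  have h2 := intervalIntegral.norm_integral_le_of_norm_le_const (a := a) (b := b) fun x _ =>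
    norm_div_sub_mul_sin_horizontal_le (t := t) (s := Y) hb hw hγ hY (abs_of_pos hY) hsinh x
  have h3 := norm_integral_le_of_norm_le_exp_neg_abs (sub_pos.2 hγ) hY.le
    (norm_div_sub_mul_sin_vertical_le hb hw hb1 htb.ne')
  have h4 := norm_integral_le_of_norm_le_exp_neg_abs (sub_pos.2 hγ) hY.le
    (norm_div_sub_mul_sin_vertical_le hb hw ha hat.ne)
  rw [abs_of_pos (by linarith)] at h1 h2 h3
  rw [abs_of_neg (by linarith)] at h4
  have h5 : ∀ A B C D : ℂ, ‖A - B + Complex.I * C - Complex.I * D‖ ≤ ‖A‖ + ‖B‖ + ‖C‖ + ‖D‖ :=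
    fun A B C D => by
      refine (norm_sub_le _ _).trans (add_le_add ((norm_add_le _ _).trans
        (add_le_add (norm_sub_le _ _) ?_)) ?_) <;> simp
  refine (h5 _ _ _ _).trans ((add_le_add (add_le_add (add_le_add h1 h2) h3) h4).trans_eq ?_)
  rw [neg_sub]
  ring

/-! ### The remainder of the sampling series of a function -/

theorem sin_half_integer_mul_pi_sq (k : ℤ) : Real.sin ((k + 1 / 2) * Real.pi) ^ 2 = 1 := by
  rw [show ((k : ℝ) + 1 / 2) * Real.pi = k * Real.pi + Real.pi / 2 by ring,
    Real.sin_add_pi_div_two, Real.cos_sq']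
  simp

theorem sinc_sub_int_mul_pi {x : ℝ} {n : ℤ} (h : x - n * Real.pi ≠ 0) :
    Real.sinc (x - n * Real.pi) = Real.sin x * Real.cos (n * Real.pi) / (x - n * Real.pi) := by
  rw [Real.sinc_of_ne_zero h, Real.sin_sub, Real.sin_int_mul_pi]
  ring

/-- The remainder of the truncated sampling series of a function bounded by `L exp (γ |Im z|)`. -/
theorem norm_sub_sum_sinc_le {g : ℂ → ℂ} (hg : Differentiable ℂ g) {L γ w t : ℝ}
    (hb : ∀ z : ℂ, ‖g z‖ ≤ L * Real.exp (γ * |z.im|)) (hw : 0 < w) (hγ : γ < w)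
    (ht : Real.sin (w * t) ≠ 0) {m M : ℤ} (hm : (m - 1 / 2) * Real.pi / w < t)
    (hM : t < (M + 1 / 2) * Real.pi / w) :
    ‖g t - ∑ n ∈ Finset.Icc m M,
        g ((n * Real.pi / w : ℝ) : ℂ) * (Real.sinc (w * t - n * Real.pi) : ℂ)‖ ≤
      |Real.sin (w * t)| * (2 * L / (Real.pi * (w - γ)) *
        (1 / ((M + 1 / 2) * Real.pi / w - t) + 1 / (t - (m - 1 / 2) * Real.pi / w))) := by
  set a : ℝ := (m - 1 / 2) * Real.pi / w with ha
  set b : ℝ := (M + 1 / 2) * Real.pi / w with hb'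
  have hpi := Real.pi_pos
  have hab : a < b := hm.trans hM
  have hwt : ∀ n : ℤ, w * t - n * Real.pi ≠ 0 := fun n h => ht (by
    rw [sub_eq_zero.1 h, Real.sin_int_mul_pi])
  let pt : ℤ → ℝ := fun n => n * Real.pi / w
  have hpt : ∀ n, w * pt n = n * Real.pi := fun n => by simp only [pt]; field_simp
  have hptc : ∀ n, (w : ℂ) * (pt n : ℂ) = n * Real.pi := fun n => by exact_mod_cast hpt n
  have hptt : ∀ n, pt n ≠ t := fun n h => hwt n (by rw [← hpt, h, sub_self])
  have hinj : Function.Injective pt := fun i j hij => by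
    have := hpt i
    rw [hij, hpt] at this
    exact_mod_cast (mul_right_cancel₀ hpi.ne' this).symm
  -- The zeros of (z − t) sin(wz) in the strip: t and the nodes with index in [m, M]. They are
  -- simple because t is not a node.
  let P : Finset ℝ := insert t ((Finset.Icc m M).image pt)
  let v : ℂ → ℂ := fun z => (z - t) * Complex.sin (w * z)
  have hder : ∀ z : ℂ, HasDerivAt v (Complex.sin (w * z) + (z - t) * (w * Complex.cos (w * z)))
      z := fun z => by
    have h1 : HasDerivAt (fun z : ℂ => z - t) 1 z := (hasDerivAt_id z).sub_const _
    have h2 : HasDerivAt (fun z : ℂ => Complex.sin (w * z)) (Complex.cos (w * z) * w) z := by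
      simpa using ((hasDerivAt_id z).const_mul (w : ℂ)).csin
    convert! h1.mul h2 using 1
    ring
  have hderP : ∀ n : ℤ, deriv v (pt n) = (pt n - t) * (w * Real.cos (n * Real.pi)) := fun n => by
    rw [(hder _).deriv, hptc]
    have : Complex.sin (n * Real.pi) = 0 := by exact_mod_cast Complex.sin_int_mul_pi n
    rw [this]
    push_cast
    ring
  have hdert : deriv v t = Real.sin (w * t) := by
    rw [(hder _).deriv]
    push_cast
    ring
  have hcos : ∀ n : ℤ, Real.cos (n * Real.pi) ^ 2 = 1 := fun n => by
    rw [Real.cos_sq', Real.sin_int_mul_pi]; simp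
  have hcos0 : ∀ n : ℤ, Real.cos (n * Real.pi) ≠ 0 := fun n h => by
    simpa [h] using hcos n
  have hres := tendsto_rectIntegral_div hg (fun z => (hder z).differentiableAt) hab.le P
    ?_ ?_ ?_ ?_
  rotate_left
  · simp only [P, Finset.forall_mem_insert, Finset.forall_mem_image, Finset.mem_Icc]
    refine ⟨⟨hm, hM⟩, fun n hn => ?_⟩
    have h1 : (m : ℝ) ≤ n := by exact_mod_cast hn.1
    have h2 : (n : ℝ) ≤ M := by exact_mod_cast hn.2
    simp only [pt, ha, hb']
    constructor <;> gcongr <;> linarith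
  · simp only [P, Finset.forall_mem_insert, Finset.forall_mem_image, Finset.mem_Icc, v]
    refine ⟨by simp, fun n hn => ?_⟩
    rw [hptc]
    have : Complex.sin (n * Real.pi) = 0 := by exact_mod_cast Complex.sin_int_mul_pi n
    rw [this, mul_zero]
  · simp only [P, Finset.forall_mem_insert, Finset.forall_mem_image, Finset.mem_Icc]
    refine ⟨by rw [hdert]; exact_mod_cast ht, fun n hn => ?_⟩
    rw [hderP]
    have h1 := sub_ne_zero.2 (hptt n)
    have h2 := hcos0 n
    have h3 := hw.ne'
    exact_mod_cast mul_ne_zero h1 (mul_ne_zero h3 h2)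
  · intro z hza hzb hz
    simp only [P, Finset.forall_mem_insert, Finset.forall_mem_image, Finset.mem_Icc] at hz
    refine mul_ne_zero (sub_ne_zero.2 hz.1) fun h => ?_
    obtain ⟨k, hk⟩ := Complex.sin_eq_zero_iff.1 h
    have hzk : z = (pt k : ℝ) := by
      have : (w : ℂ) ≠ 0 := by exact_mod_cast hw.ne'
      rw [← mul_right_inj' this, hk, hptc]
    refine hz.2 ?_ hzk
    have e1 : z.re = k * Real.pi / w := by rw [hzk]; simp [pt]
    rw [e1] at hza hzb
    simp only [ha, hb'] at hza hzb
    rw [div_le_div_iff_of_pos_right hw, mul_le_mul_iff_left₀ hpi] at hza hzb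
    -- The strip extends only half a step beyond the nodes m and M, so integrality forces m ≤ k ≤ M.
    constructor
    · have : (m : ℝ) < k + 1 := by linarith
      exact Int.lt_add_one_iff.1 (by exact_mod_cast this)
    · have : (k : ℝ) < M + 1 := by linarith
      exact Int.lt_add_one_iff.1 (by exact_mod_cast this)
  -- Multiplied by sin(wt), the residue at t is g(t) and the residue at the n-th node is minus the
  -- n-th term of the series, since 1/cos(nπ) = cos(nπ).
  have hsum : g t - ∑ n ∈ Finset.Icc m M,
        g ((n * Real.pi / w : ℝ) : ℂ) * (Real.sinc (w * t - n * Real.pi) : ℂ) =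
      Real.sin (w * t) * ∑ p ∈ P, g p / deriv v p := by
    have htn : t ∉ (Finset.Icc m M).image pt := by
      simp only [Finset.mem_image, not_exists, not_and]
      exact fun n _ => hptt n
    rw [Finset.sum_insert htn, Finset.sum_image hinj.injOn, mul_add, hdert,
      mul_div_cancel₀ _ (by exact_mod_cast ht), sub_eq_add_neg, Finset.mul_sum,
      ← Finset.sum_neg_distrib]
    congr 1
    refine Finset.sum_congr rfl fun n _ => ?_
    change -(g (pt n) * _) = _
    rw [hderP, sinc_sub_int_mul_pi (hwt n), ← hpt n]
    have h1 : (pt n : ℂ) - t ≠ 0 := by exact_mod_cast sub_ne_zero.2 (hptt n)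
    have h2 : (Real.cos (w * pt n) : ℂ) ≠ 0 := by rw [hpt]; exact_mod_cast hcos0 n
    have h3 : (w : ℂ) ≠ 0 := by exact_mod_cast hw.ne'
    have h4 : (w : ℂ) * t - w * pt n ≠ 0 := by
      rw [hptc]; exact_mod_cast hwt n
    have h5 : (Real.cos (w * pt n) : ℂ) ^ 2 = 1 := by rw [hpt]; exact_mod_cast hcos n
    push_cast at h2 h5 ⊢
    have h6 : (w : ℂ) * t - w * pt n = -(w * (pt n - t)) := by ring
    rw [h6]
    field_simp
    rw [h5, mul_one]
  have hle : ‖2 * Real.pi * Complex.I * ∑ p ∈ P, g p / deriv v p‖ ≤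
      4 * L / (w - γ) * (1 / (b - t) + 1 / (t - a)) := by
    have hlim : Tendsto (fun Y : ℝ => 8 * L * (b - a) * Y⁻¹ +
        4 * L / (w - γ) * (1 / (b - t) + 1 / (t - a))) atTop
        (nhds (4 * L / (w - γ) * (1 / (b - t) + 1 / (t - a)))) := by
      simpa using (tendsto_inv_atTop_zero.const_mul (8 * L * (b - a))).add_const
        (4 * L / (w - γ) * (1 / (b - t) + 1 / (t - a)))
    refine le_of_tendsto_of_tendsto hres.norm hlim ?_
    filter_upwards [eventually_gt_atTop 0, eventually_exp_le_four_mul_sinh hw] with Y hY hs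
    refine norm_rectIntegral_div_sub_mul_sin_le hb hw hγ hY hs hm hM ?_ ?_
    · have : w * a = ((m - 1 : ℤ) + 1 / 2) * Real.pi := by
        simp only [ha]; push_cast; field_simp; ring
      rw [this, sin_half_integer_mul_pi_sq]
    · have : w * b = (M + 1 / 2) * Real.pi := by
        simp only [hb']; field_simp
      rw [this, sin_half_integer_mul_pi_sq]
  rw [hsum, norm_mul, Complex.norm_real, Real.norm_eq_abs]
  refine mul_le_mul_of_nonneg_left ?_ (abs_nonneg _)
  simp only [norm_mul, Complex.norm_I, mul_one, Complex.norm_real, Complex.norm_ofNat,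
    Real.norm_eq_abs, abs_of_pos hpi] at hle
  have e : 2 * L / (Real.pi * (w - γ)) * (1 / (b - t) + 1 / (t - a)) =
      4 * L / (w - γ) * (1 / (b - t) + 1 / (t - a)) / (2 * Real.pi) := by
    have := (sub_pos.2 hγ).ne'
    field_simp
    ring
  rw [e, le_div_iff₀ (by positivity)]
  linarith

/-! ### Transfer from the kernel to the process -/

/-- The isometry between linear combinations of the values of a Piranashvili process and those of its
kernel. -/
theorem IsPiranashvili.lintegral_sum_sq {Ω Λ ι : Type*} [MeasurableSpace Ω] [MeasurableSpace Λ]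
    {P : Measure Ω} {ξ : ℝ → Ω → ℂ} {f : ℂ → Λ → ℂ} {F : ComplexMeasure (Λ × Λ)}
    (hξ : IsPiranashvili P ξ f F) (s : Finset ι) (r τ : ι → ℝ) :
    ∫⁻ ω, ‖∑ i ∈ s, ξ (τ i) ω * (r i : ℂ)‖ₑ ^ 2 ∂P =
      ‖F.integral (fun p : Λ × Λ => (∑ i ∈ s, f (τ i : ℂ) p.1 * (r i : ℂ)) *
        conj (∑ i ∈ s, f (τ i : ℂ) p.2 * (r i : ℂ))) (ContinuousLinearMap.mul ℝ ℂ)‖ₑ := by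
  set X : Ω → ℂ := fun ω => ∑ i ∈ s, ξ (τ i) ω * (r i : ℂ) with hX
  have hXm : MemLp X 2 P := memLp_finsetSum s fun i _ => (hξ.memLp (τ i)).mul_const _
  -- The integral of X conj(X) is a nonnegative real, so taking its norm loses nothing.
  have h1 : ∫⁻ ω, ‖X ω‖ₑ ^ 2 ∂P = ‖∫ ω, X ω * conj (X ω) ∂P‖ₑ := by
    have e : ∀ ω, X ω * conj (X ω) = ((‖X ω‖ ^ 2 : ℝ) : ℂ) := fun ω => by
      rw [Complex.mul_conj']; push_cast; rfl
    have hnn : 0 ≤ ∫ ω, ‖X ω‖ ^ 2 ∂P := integral_nonneg fun ω => by positivity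
    simp only [e]
    rw [integral_complex_ofReal, ← ofReal_norm, Complex.norm_real, Real.norm_of_nonneg hnn,
      ofReal_integral_eq_lintegral_ofReal (hXm.integrable_norm_pow two_ne_zero)
        (Eventually.of_forall fun ω => by positivity)]
    refine lintegral_congr fun ω => ?_
    rw [ENNReal.ofReal_pow (norm_nonneg _), ofReal_norm]
  have hint : ∀ i j, Integrable (fun ω => ξ (τ i) ω * conj (ξ (τ j) ω)) P := fun i j =>
    (hξ.memLp (τ i)).integrable_mul (hξ.memLp (τ j)).star
  have hint' : ∀ i j, Integrable
      (fun ω => (r i * r j : ℝ) • (ξ (τ i) ω * conj (ξ (τ j) ω))) P := fun i j =>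
    (hint i j).smul (r i * r j)
  have hintF : ∀ i j, Integrable (fun p : Λ × Λ =>
      (r i * r j : ℝ) • (f (τ i : ℂ) p.1 * conj (f (τ j : ℂ) p.2))) F.variation := fun i j =>
    (hξ.integrable (τ i) (τ j)).smul (r i * r j)
  have h2 : ∫ ω, X ω * conj (X ω) ∂P =
      ∑ i ∈ s, ∑ j ∈ s, (r i * r j : ℝ) • ∫ ω, ξ (τ i) ω * conj (ξ (τ j) ω) ∂P := by
    have e : ∀ ω, X ω * conj (X ω) =
        ∑ i ∈ s, ∑ j ∈ s, (r i * r j : ℝ) • (ξ (τ i) ω * conj (ξ (τ j) ω)) := fun ω => by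
      simp only [hX, map_sum, map_mul, Complex.conj_ofReal, Finset.sum_mul_sum, Complex.real_smul]
      refine Finset.sum_congr rfl fun i _ => Finset.sum_congr rfl fun j _ => ?_
      push_cast; ring
    simp only [e]
    rw [integral_finsetSum _ fun i _ => integrable_finsetSum _ fun j _ => hint' i j]
    refine Finset.sum_congr rfl fun i _ => ?_
    rw [integral_finsetSum _ fun j _ => hint' i j]
    exact Finset.sum_congr rfl fun j _ => integral_smul _ _
  have h3 : F.integral (fun p : Λ × Λ => (∑ i ∈ s, f (τ i : ℂ) p.1 * (r i : ℂ)) *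
        conj (∑ i ∈ s, f (τ i : ℂ) p.2 * (r i : ℂ))) (ContinuousLinearMap.mul ℝ ℂ) =
      ∑ i ∈ s, ∑ j ∈ s, (r i * r j : ℝ) •
        F.integral (fun p : Λ × Λ => f (τ i : ℂ) p.1 * conj (f (τ j : ℂ) p.2))
          (ContinuousLinearMap.mul ℝ ℂ) := by
    have e : ∀ p : Λ × Λ, (∑ i ∈ s, f (τ i : ℂ) p.1 * (r i : ℂ)) *
        conj (∑ i ∈ s, f (τ i : ℂ) p.2 * (r i : ℂ)) =
        ∑ i ∈ s, ∑ j ∈ s, (r i * r j : ℝ) • (f (τ i : ℂ) p.1 * conj (f (τ j : ℂ) p.2)) :=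
      fun p => by
        simp only [map_sum, map_mul, Complex.conj_ofReal, Finset.sum_mul_sum, Complex.real_smul]
        refine Finset.sum_congr rfl fun i _ => Finset.sum_congr rfl fun j _ => ?_
        push_cast; ring
    simp only [e]
    rw [VectorMeasure.integral_finsetSum _ fun i _ => integrable_finsetSum _ fun j _ => hintF i j]
    refine Finset.sum_congr rfl fun i _ => ?_
    rw [VectorMeasure.integral_finsetSum _ fun j _ => hintF i j]
    exact Finset.sum_congr rfl fun j _ => VectorMeasure.integral_fun_smul _ _ _ _
  rw [h1, h2, h3]
  simp only [hξ.covariance]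

/-- The integrand in the isometry is a product of one factor in l and one in m, each bounded by C;
the total variation bounds the rest. -/
theorem IsPiranashvili.lintegral_sum_sq_le {Ω Λ ι : Type*} [MeasurableSpace Ω]
    [MeasurableSpace Λ] {P : Measure Ω} {ξ : ℝ → Ω → ℂ} {f : ℂ → Λ → ℂ}
    {F : ComplexMeasure (Λ × Λ)} (hξ : IsPiranashvili P ξ f F) (s : Finset ι) (r τ : ι → ℝ)
    {C : ℝ≥0∞} (hC : ∀ l, ‖∑ i ∈ s, f (τ i : ℂ) l * (r i : ℂ)‖ₑ ≤ C) :
    ∫⁻ ω, ‖∑ i ∈ s, ξ (τ i) ω * (r i : ℂ)‖ₑ ^ 2 ∂P ≤ C ^ 2 * F.variation Set.univ := by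
  have hB : ‖ContinuousLinearMap.mul ℝ ℂ‖ₑ ≤ 1 := by
    rw [← ofReal_norm]
    simp
  rw [hξ.lintegral_sum_sq]
  refine (VectorMeasure.enorm_integral_le_of_enorm_le_const (C := C ^ 2)
    (Eventually.of_forall fun p => ?_)).trans ?_
  · rw [enorm_mul, sq, RCLike.enorm_conj]
    exact mul_le_mul' (hC p.1) (hC p.2)
  · calc _ ≤ C ^ 2 * 1 * F.variation Set.univ := by gcongr
      _ = _ := by rw [mul_one]

/-- The truncation error is a linear combination of the values of the process. -/
theorem sub_truncSum_eq_sum {Ω : Type*} (w : ℝ) (N : ℕ) (ξ : ℝ → Ω → ℂ) (t : ℝ) (ω : Ω) :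
    ξ t ω - truncSum w N ξ t ω = ∑ i ∈ Finset.insertNone (sampleIndices w N t),
      ξ (i.elim t fun n => n * Real.pi / w) ω *
        ((i.elim 1 fun n : ℤ => -Real.sinc (w * t - n * Real.pi) : ℝ) : ℂ) := by
  rw [Finset.sum_insertNone]
  simp [truncSum, sub_eq_add_neg]

/-- Here t is itself a node, lies in its own sampling window, and every other sinc vanishes. The
residue argument excludes this case because the pole at t would be double. -/
theorem truncSum_of_sin_eq_zero {Ω : Type*} {w : ℝ} (hw : 0 < w) (N : ℕ) (ξ : ℝ → Ω → ℂ) {t : ℝ}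
    (ht : Real.sin (w * t) = 0) (ω : Ω) : truncSum w N ξ t ω = ξ t ω := by
  obtain ⟨k, hk⟩ := Real.sin_eq_zero_iff.1 ht
  have hpi := Real.pi_pos
  have htk : t = k * Real.pi / w := by rw [hk]; field_simp
  have hkS : k ∈ sampleIndices w N t := by
    rw [mem_sampleIndices]
    have : t * w / Real.pi - k = 0 := by rw [mul_comm, ← hk]; field_simp; simp
    simp [this]
  rw [truncSum, Finset.sum_eq_single_of_mem k hkS fun n _ hn => ?_]
  · rw [← htk, hk, sub_self, Real.sinc_zero]
    simp
  · have h : w * t - n * Real.pi ≠ 0 := by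
      rw [← hk, ← sub_mul]
      refine mul_ne_zero (sub_ne_zero.2 ?_) hpi.ne'
      exact_mod_cast hn.symm
    rw [sinc_sub_int_mul_pi h, ht]
    simp

/-- The limsup controls growth only for exponents τ > γ. As the bound L on the real axis does not
depend on τ, letting τ decrease to γ gives the endpoint. -/
theorem norm_kernel_le {Λ : Type*} {f : ℂ → Λ → ℂ} (hf : IsExpBoundedKernel f)
    (hγ : kernelType f ≠ ∞) (hL : kernelSup f ≠ ∞) (l : Λ) (z : ℂ) :
    ‖f z l‖ ≤ (kernelSup f).toReal * Real.exp ((kernelType f).toReal * |z.im|) := by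
  have hd := (hf l).1
  have hreal : ∀ x : ℝ, ‖f x l‖ ≤ (kernelSup f).toReal := fun x => by
    rw [← toReal_enorm]
    exact ENNReal.toReal_mono hL (le_iSup₂ (f := fun (t : ℝ) (l : Λ) => ‖f (t : ℂ) l‖ₑ) x l)
  have hτ : ∀ τ : ℝ, (kernelType f).toReal < τ →
      ‖f z l‖ ≤ (kernelSup f).toReal * Real.exp (τ * |z.im|) := fun τ h => by
    have hlt : limsup (fun n : ℕ => ‖iteratedDeriv n (fun z => f z l) 0‖ₑ ^ ((1 : ℝ) / n)) atTop <
        ENNReal.ofReal τ := by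
      refine (le_iSup (fun l : Λ => limsup (fun n : ℕ =>
        ‖iteratedDeriv n (fun z => f z l) 0‖ₑ ^ ((1 : ℝ) / n)) atTop) l).trans_lt ?_
      exact (ENNReal.lt_ofReal_iff_toReal_lt hγ).2 h
    obtain ⟨C, hC⟩ := exists_norm_le_exp_of_limsup_lt hd hlt
    exact norm_le_exp_abs_im hd hC hreal z
  have hcont : Continuous fun τ : ℝ => (kernelSup f).toReal * Real.exp (τ * |z.im|) := by fun_prop
  refine ge_of_tendsto ((hcont.tendsto (kernelType f).toReal).mono_left
    (nhdsWithin_le_nhds (s := Set.Ioi (kernelType f).toReal))) ?_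
  filter_upwards [self_mem_nhdsWithin] with τ h using hτ τ h

/-! ### Constants and the final estimate -/

/-- The real number represented by `truncConst` for a kernel bounded on the real axis. -/
noncomputable def truncConstReal {Λ : Type*} (w : ℝ) (f : ℂ → Λ → ℂ) (t : ℝ) : ℝ :=
  4 * (kernelSup f).toReal * (w * |Real.sin (w * t)| /
    (Real.pi * (w - (kernelType f).toReal) * (1 - Real.exp (-Real.pi))))

theorem truncConst_eq_ofReal {Λ : Type*} (w : ℝ) {f : ℂ → Λ → ℂ} (hL : kernelSup f ≠ ∞) (t : ℝ) :
    truncConst w f t = ENNReal.ofReal (truncConstReal w f t) := by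
  rw [truncConst, truncConstReal, ENNReal.ofReal_mul (by positivity),
    ENNReal.ofReal_mul (by positivity), ENNReal.ofReal_toReal hL]
  norm_num

theorem norm_kernel_sub_sum_sinc_le {Λ : Type*} {f : ℂ → Λ → ℂ} (hf : IsExpBoundedKernel f)
    {w : ℝ} (hw : kernelType f < ENNReal.ofReal w) (hL : kernelSup f ≠ ∞) {t : ℝ}
    (ht : Real.sin (w * t) ≠ 0) {N : ℕ} (hN : 1 ≤ N) (l : Λ) :
    ‖f t l - ∑ n ∈ sampleIndices w N t,
        f ((n * Real.pi / w : ℝ) : ℂ) l * (Real.sinc (w * t - n * Real.pi) : ℂ)‖ ≤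
      2 / 3 * (truncConstReal w f t / N) := by
  have hw0 : 0 < w := ENNReal.ofReal_pos.1 (bot_le.trans_lt hw)
  have hγ' : kernelType f ≠ ∞ := (hw.trans ENNReal.ofReal_lt_top).ne
  have hγ : (kernelType f).toReal < w := (ENNReal.lt_ofReal_iff_toReal_lt hγ').1 hw
  have hpi := Real.pi_pos
  have hN1 : (1 : ℝ) ≤ N := by exact_mod_cast hN
  set x : ℝ := t * w / Real.pi with hx
  have htx : t = x * Real.pi / w := by rw [hx]; field_simp
  -- Since ⌊x + N⌋ > x + N − 1, the right side lies more than N − 1/2 ≥ N/2 steps from t; the left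
  -- side is symmetric.
  have hM : N / 2 * Real.pi / w ≤ (⌊x + N⌋ + 1 / 2) * Real.pi / w - t := by
    rw [htx, ← sub_div, ← sub_mul]
    have := Int.lt_floor_add_one (x + N)
    gcongr
    linarith
  have hm : N / 2 * Real.pi / w ≤ t - (⌈x - N⌉ - 1 / 2) * Real.pi / w := by
    rw [htx, ← sub_div, ← sub_mul]
    have := Int.ceil_lt_add_one (x - N)
    gcongr
    linarith
  have hd : 0 < N / 2 * Real.pi / w := by positivity
  refine (norm_sub_sum_sinc_le (hf l).1 (norm_kernel_le hf hγ' hL l) hw0 hγ ht (m := ⌈x - N⌉)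
    (M := ⌊x + N⌋) (by linarith) (by linarith)).trans ?_
  have hE0 : 0 < Real.exp (-Real.pi) := Real.exp_pos _
  have hE1 : Real.exp (-Real.pi) < 1 := Real.exp_lt_one_iff.2 (by linarith)
  have hδ : 0 < w - (kernelType f).toReal := sub_pos.2 hγ
  calc _ ≤ |Real.sin (w * t)| * (2 * (kernelSup f).toReal / (Real.pi *
        (w - (kernelType f).toReal)) * (1 / (N / 2 * Real.pi / w) + 1 / (N / 2 * Real.pi / w))) := by
        gcongr
    -- The surplus factor 2/π is at most 2/3 as π > 3; the 1 in the denominator is then lowered to 1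
    -- − exp(−π), which only enlarges the bound.
    _ = 2 / Real.pi * (4 * (kernelSup f).toReal * (w * |Real.sin (w * t)| /
          (Real.pi * (w - (kernelType f).toReal) * 1)) / N) := by
        field_simp
        ring
    _ ≤ _ := by
        rw [truncConstReal]
        gcongr
        · exact Real.pi_gt_three.le
        · linarith

/-- Supplies strictness when the right-hand side is infinite. -/
theorem IsPiranashvili.lintegral_sub_truncSum_lt_top {Ω Λ : Type*} [MeasurableSpace Ω]
    [MeasurableSpace Λ] {P : Measure Ω} {ξ : ℝ → Ω → ℂ} {f : ℂ → Λ → ℂ}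
    {F : ComplexMeasure (Λ × Λ)} (hξ : IsPiranashvili P ξ f F) (w : ℝ) (N : ℕ) (t : ℝ) :
    ∫⁻ ω, ‖ξ t ω - truncSum w N ξ t ω‖ₑ ^ 2 ∂P < ∞ := by
  simp only [sub_truncSum_eq_sum]
  rw [hξ.lintegral_sum_sq]
  exact enorm_lt_top

theorem IsPiranashvili.lintegral_sub_truncSum_le {Ω Λ : Type*} [MeasurableSpace Ω]
    [MeasurableSpace Λ] {P : Measure Ω} {ξ : ℝ → Ω → ℂ} {f : ℂ → Λ → ℂ}
    {F : ComplexMeasure (Λ × Λ)} (hξ : IsPiranashvili P ξ f F) {w t : ℝ} {N : ℕ} {C : ℝ≥0∞}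
    (hC : ∀ l, ‖f t l - ∑ n ∈ sampleIndices w N t,
      f ((n * Real.pi / w : ℝ) : ℂ) l * (Real.sinc (w * t - n * Real.pi) : ℂ)‖ₑ ≤ C) :
    ∫⁻ ω, ‖ξ t ω - truncSum w N ξ t ω‖ₑ ^ 2 ∂P ≤ C ^ 2 * F.variation Set.univ := by
  simp only [sub_truncSum_eq_sum]
  refine hξ.lintegral_sum_sq_le _ _ _ fun l => ?_
  -- The same algebraic identity, with Λ in the role of Ω and the kernel in the role of the process.
  rw [← sub_truncSum_eq_sum w N (fun (t : ℝ) l => f t l) t l]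
  exact hC l

theorem theorem2 {Ω Λ : Type*} [MeasurableSpace Ω] [MeasurableSpace Λ]
    (P : Measure Ω) [IsProbabilityMeasure P]
    (ξ : ℝ → Ω → ℂ) (f : ℂ → Λ → ℂ) (F : ComplexMeasure (Λ × Λ))
    (hξ : IsPiranashvili P ξ f F)
    (w : ℝ) (hw : kernelType f < ENNReal.ofReal w) :
    ∃ N₀ : ℕ, ∀ N : ℕ, N₀ ≤ N → ∀ t : ℝ,
      (∫⁻ ω, ‖ξ t ω - truncSum w N ξ t ω‖ₑ ^ 2 ∂P ≤
        truncConst w f t ^ 2 / (N : ℝ≥0∞) ^ 2 * F.variation Set.univ) ∧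
      (Real.sin (w * t) ≠ 0 → kernelSup f ≠ 0 → F.variation Set.univ ≠ 0 →
        ∫⁻ ω, ‖ξ t ω - truncSum w N ξ t ω‖ₑ ^ 2 ∂P <
          truncConst w f t ^ 2 / (N : ℝ≥0∞) ^ 2 * F.variation Set.univ) := by
  refine ⟨1, fun N hN t => ?_⟩
  have hw0 : 0 < w := ENNReal.ofReal_pos.1 (bot_le.trans_lt hw)
  have hγ : (kernelType f).toReal < w :=
    (ENNReal.lt_ofReal_iff_toReal_lt (hw.trans ENNReal.ofReal_lt_top).ne).1 hw
  have hN0 : (0 : ℝ) < N := by exact_mod_cast hN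
  have hpi := Real.pi_pos
  have hE1 : Real.exp (-Real.pi) < 1 := Real.exp_lt_one_iff.2 (by linarith)
  by_cases ht : Real.sin (w * t) = 0
  · refine ⟨?_, fun h => absurd ht h⟩
    simp [truncSum_of_sin_eq_zero hw0 N ξ ht]
  have hfac : 0 < w * |Real.sin (w * t)| /
      (Real.pi * (w - (kernelType f).toReal) * (1 - Real.exp (-Real.pi))) := by
    have h1 := sub_pos.2 hγ
    have h2 := sub_pos.2 hE1
    have h3 := abs_pos.2 ht
    positivity
  by_cases hL : kernelSup f = ∞
  · by_cases hV : F.variation Set.univ = 0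
    · refine ⟨?_, fun _ _ h => absurd hV h⟩
      -- With zero variation the trivial bound C = ∞ already gives error 0, because ∞ · 0 = 0.
      have := hξ.lintegral_sub_truncSum_le (w := w) (t := t) (N := N) (C := ∞) fun l => le_top
      rw [hV, mul_zero] at this ⊢
      exact this
    · have htop : truncConst w f t ^ 2 / (N : ℝ≥0∞) ^ 2 * F.variation Set.univ = ∞ := by
        have h1 : truncConst w f t = ∞ := by
          rw [truncConst, hL, ENNReal.mul_top (by norm_num),
            ENNReal.top_mul (ENNReal.ofReal_pos.2 hfac).ne']
        rw [h1, ENNReal.top_pow two_ne_zero, ENNReal.top_div_of_ne_top (by finiteness),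
          ENNReal.top_mul hV]
      rw [htop]
      exact ⟨le_top, fun _ _ _ => hξ.lintegral_sub_truncSum_lt_top w N t⟩
  · have hK0 : 0 ≤ truncConstReal w f t := by
      rw [truncConstReal]; positivity
    have hRHS : truncConst w f t ^ 2 / (N : ℝ≥0∞) ^ 2 =
        ENNReal.ofReal ((truncConstReal w f t / N) ^ 2) := by
      rw [truncConst_eq_ofReal w hL, div_pow, ENNReal.ofReal_div_of_pos (by positivity),
        ENNReal.ofReal_pow hK0, ENNReal.ofReal_pow hN0.le, ENNReal.ofReal_natCast]
    have hle : ∫⁻ ω, ‖ξ t ω - truncSum w N ξ t ω‖ₑ ^ 2 ∂P ≤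
        ENNReal.ofReal ((2 / 3 * (truncConstReal w f t / N)) ^ 2) * F.variation Set.univ := by
      rw [ENNReal.ofReal_pow (by positivity)]
      refine hξ.lintegral_sub_truncSum_le fun l => ?_
      rw [← ofReal_norm]
      exact ENNReal.ofReal_le_ofReal (norm_kernel_sub_sum_sinc_le hξ.kernel hw hL ht hN l)
    rw [hRHS]
    constructor
    · refine hle.trans ?_
      gcongr
      have : 0 ≤ truncConstReal w f t / N := by positivity
      linarith
    · intro _ hL0 hV
      -- The factor 2/3 gives strictness once the variation is finite and nonzero and the constant
      -- is positive.
      refine hle.trans_lt ((ENNReal.mul_lt_mul_iff_left hV hξ.finiteVariation.ne).2 ?_)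
      have hpos : 0 < truncConstReal w f t / N := by
        have := ENNReal.toReal_pos hL0 hL
        rw [truncConstReal]; positivity
      rw [ENNReal.ofReal_lt_ofReal_iff (by positivity)]
      gcongr
      linarith
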